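/- Let $n\ge 1$, and let $a_i,b_i,c_i,d_i$ ($1\le i\le n$) be positive real numbers. Draw the Aztec diamond graph $AD_n$ with diagonal edges: its vertices are the points $(r,s)\in\{0,\dots,2n\}^2$ ($r$ the row, $s$ the column) with $r+s$ odd, and two vertices are adjacent when both coordinates differ by exactly $1$. The centers of the edges form a $2n\times 2n$ array; weight the edges by placing the $4\times 2n$ matrix $$A=\begin{bmatrix} a_1&b_1&a_2&b_2&\cdots&a_n&b_n\\ a_1&b_1&a_2&b_2&\cdots&a_n&b_n\\ c_1&d_1&c_2&d_2&\cdots&c_n&d_n\\ c_1&d_1&c_2&d_2&\cdots&c_n&d_n \end{bmatrix}$$ in the upper left corner of this array, repeating it periodically (downwards with period $4$, cutting off what lies outside the array), and giving each edge the corresponding entry. Let $M(AD_n(\mathrm{wt}_A))$ be the matching generating function, i.e. the sum, over all perfect matchings of $AD_n$, of the product of the weights of the edges in the matching. Then: (a) If $n=2k$, then $$M(AD_n(\mathrm{wt}_A))=2^{k(k+1)}\prod_{i=1}^{k}(a_ib_{n-i+1}c_id_{n-i+1})^{k-i+1}\;\prod_{j=1}^{k}\prod_{i=j}^{n-j}(d_ia_{i+1}+b_ic_{i+1}).$$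 (b) If $n=2k+1$, then $$M(AD_n(\mathrm{wt}_A))=2^{(k+1)^2}\prod_{i=1}^{k+1}(a_ib_{n-i+1})^{k-i+2}(c_id_{n-i+1})^{k-i+1}\;\prod_{j=1}^{k}\prod_{i=j}^{n-j}(d_ia_{i+1}+b_ic_{i+1}).$$ -/

import Mathlib

/-- The vertices of the Aztec diamond graph of order `n`, drawn so that its edges are diagonal:
the points `(row, column)` of the grid `{0, …, 2n} × {0, …, 2n}` with odd coordinate sum
(rows are counted downwards and columns to the right). -/
abbrev AztecVertex (n : ℕ) : Type :=
  {p : Fin (2 * n + 1) × Fin (2 * n + 1) // Odd ((p.1 : ℕ) + (p.2 : ℕ))}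

namespace AztecVertex

/-- The row of a vertex, between `0` and `2n`. -/
def row {n : ℕ} (p : AztecVertex n) : ℕ := (p.1.1 : ℕ)

/-- The column of a vertex, between `0` and `2n`. -/
def col {n : ℕ} (p : AztecVertex n) : ℕ := (p.1.2 : ℕ)

end AztecVertex

/-- The Aztec diamond graph `AD_n`: two vertices are adjacent when they differ by a unit diagonal
step. Each of the `2n × 2n` unit squares of the grid has exactly two corners with odd coordinate
sum, so it contains exactly one edge, whose center is the center of the square. -/
def aztecDiamond (n : ℕ) : SimpleGraph (AztecVertex n) where
  Adj p q := (p.row + 1 = q.row ∨ q.row + 1 = p.row) ∧ (p.col + 1 = q.col ∨ q.col + 1 = p.col)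
  symm := ⟨fun _ _ h => ⟨h.1.symm, h.2.symm⟩⟩
  loopless := ⟨fun p h => by have := h.1; omega⟩

/-- The edge weights of `AD_n` read off from an array `W`: the edge in the unit square whose upper
left corner is `(r, c)` has weight `W r c`. The weight matrix is thus the part `r, c < 2n` of `W`,
with rows and columns counted from `0`; no other entry of `W` is the weight of an edge. -/
def aztecWeight (n : ℕ) (W : ℕ → ℕ → ℝ) : Sym2 (AztecVertex n) → ℝ :=
  Sym2.lift ⟨fun p q => W (min p.row q.row) (min p.col q.col), fun p q => by
    simp only [min_comm]⟩

open Classical in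
/-- The matching generating function of a finite weighted graph: the sum over all perfect matchings
of the product of the weights of the edges in the matching. -/
noncomputable def matchingGF {V : Type*} [Fintype V] (G : SimpleGraph V) (w : Sym2 V → ℝ) : ℝ :=
  ∑ M : G.Subgraph with M.IsPerfectMatching, ∏ e ∈ M.edgeSet.toFinset, w e

/-- The array obtained by repeating a `k × l` matrix periodically, starting from the upper left
corner. -/
def periodicArray {k l : ℕ} [NeZero k] [NeZero l] (A : Matrix (Fin k) (Fin l) ℝ) : ℕ → ℕ → ℝ :=
  fun r s => A (Fin.ofNat k r) (Fin.ofNat l s)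

/-- `M(AD_n(wt_A))`: the matching generating function of the Aztec diamond graph of order `n` with
weight pattern `A`. -/
noncomputable def aztecGF (n : ℕ) {k l : ℕ} [NeZero k] [NeZero l]
    (A : Matrix (Fin k) (Fin l) ℝ) : ℝ :=
  matchingGF (aztecDiamond n) (aztecWeight n (periodicArray A))

/-- The `4 × 2n` weight pattern with rows (counted from `0`)
`0, 1`: `a 1, b 1, a 2, b 2, …, a n, b n` and `2, 3`: `c 1, d 1, c 2, d 2, …, c n, d n`. -/
def fourRowPattern (n : ℕ) (a b c d : ℕ → ℝ) : Matrix (Fin 4) (Fin (2 * n)) ℝ :=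
  Matrix.of fun r s =>
    if (r : ℕ) < 2 then
      if (s : ℕ) % 2 = 0 then a ((s : ℕ) / 2 + 1) else b ((s : ℕ) / 2 + 1)
    else
      if (s : ℕ) % 2 = 0 then c ((s : ℕ) / 2 + 1) else d ((s : ℕ) / 2 + 1)

/-! The proof is urban renewal, carried out in all cells at once. Since each unit square holds one
edge, a matching is a set of squares. The squares split into `2 × 2` blocks, each a 4-cycle of
edges; an inner vertex lies in two blocks, a vertex on the boundary of the grid in one. A perfect
matching determines, for each inner vertex, which of its two blocks covers it. For a fixed such
state the weighted sum is a product over the blocks (`sum_isPerfectOn`).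

Complement the state everywhere. In a 4-cycle with factor `Δ`, the sum of its two perfect matchings,
covering nothing (weight 1) is exchanged with covering everything (weight `Δ`), and an edge with the
opposite edge. So each block sum equals `Δ` times the complementary block sum for the renewed
weights (`blockGF_renewal`). The complemented boundary vertices are uncovered, which leaves `AD_n`
inside `AD_{n+1}`; this gives `gf_succ`.

Two renewals turn the four-row pattern into one of the same shape, with inverted and shifted
sequences, up to column factors that `gf_mul_column` extracts. The resulting recursion from `n` to
`n + 2` is `gf_pattern_add_two`. The product formula obeys the same recursion
(`closedForm_add_two`), and the cases `n = 0, 1` are immediate. -/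

namespace AztecSquares

/-! ### Perfect matchings as sets of unit squares -/

open Finset

/-- The vertex `(2i + 1, 2j)` of the edge in the unit square `e`, recorded as `(i, j)`. -/
def aVertex (e : ℕ × ℕ) : ℕ × ℕ := (e.1 / 2, (e.2 + 1) / 2)

/-- The vertex `(2i, 2j + 1)` of the edge in the unit square `e`, recorded as `(i, j)`. -/
def bVertex (e : ℕ × ℕ) : ℕ × ℕ := ((e.1 + 1) / 2, e.2 / 2)

/-- The unit squares of the grid in which `AD_n` is drawn. -/
def squares (n : ℕ) : Finset (ℕ × ℕ) := range (2 * n) ×ˢ range (2 * n)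

lemma mem_squares {n : ℕ} {e : ℕ × ℕ} : e ∈ squares n ↔ e.1 < 2 * n ∧ e.2 < 2 * n := by
  simp [squares]

/-- The edges in the squares of `S` form a perfect matching of `AD_n`. -/
def IsPerfect (n : ℕ) (S : Finset (ℕ × ℕ)) : Prop :=
  (∀ p ∈ range n ×ˢ range (n + 1), #{e ∈ S | aVertex e = p} = 1) ∧
    ∀ p ∈ range (n + 1) ×ˢ range n, #{e ∈ S | bVertex e = p} = 1

/-- The matching generating function of `AD_n` with weight array `W`. -/
noncomputable def gf (n : ℕ) (W : ℕ → ℕ → ℝ) : ℝ :=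
  matchingGF (aztecDiamond n) (aztecWeight n W)

variable {n : ℕ}

/-- The upper left corner of the unit square spanned by two adjacent vertices. -/
def squareOf (p q : AztecVertex n) : ℕ × ℕ := (min p.row q.row, min p.col q.col)

lemma squareOf_comm (p q : AztecVertex n) : squareOf p q = squareOf q p := by
  simp only [squareOf, min_comm]

/-- The vertex `v` is a corner of the unit square `e`. -/
def Touches (e : ℕ × ℕ) (v : AztecVertex n) : Prop :=
  (e.1 = v.row ∨ e.1 + 1 = v.row) ∧ (e.2 = v.col ∨ e.2 + 1 = v.col)

lemma vertex_ext {p q : AztecVertex n} (hr : p.row = q.row) (hc : p.col = q.col) : p = q :=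
  Subtype.ext (Prod.ext (Fin.ext hr) (Fin.ext hc))

lemma row_lt (p : AztecVertex n) : p.row < 2 * n + 1 := p.1.1.2

lemma col_lt (p : AztecVertex n) : p.col < 2 * n + 1 := p.1.2.2

lemma odd_row_add_col (p : AztecVertex n) : (p.row + p.col) % 2 = 1 := Nat.odd_iff.mp p.2

lemma exists_vertex {r c : ℕ} (hr : r < 2 * n + 1) (hc : c < 2 * n + 1)
    (h : (r + c) % 2 = 1) : ∃ p : AztecVertex n, p.row = r ∧ p.col = c :=
  ⟨⟨(⟨r, hr⟩, ⟨c, hc⟩), Nat.odd_iff.mpr h⟩, rfl, rfl⟩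

lemma adj_iff {p q : AztecVertex n} : (aztecDiamond n).Adj p q ↔
    (p.row + 1 = q.row ∨ q.row + 1 = p.row) ∧ (p.col + 1 = q.col ∨ q.col + 1 = p.col) := Iff.rfl

lemma squareOf_mem {p q : AztecVertex n} (h : (aztecDiamond n).Adj p q) :
    squareOf p q ∈ squares n := by
  rw [adj_iff] at h
  have := row_lt p; have := row_lt q; have := col_lt p; have := col_lt q
  simp only [mem_squares, squareOf]
  omega

lemma touches_squareOf {p q : AztecVertex n} (h : (aztecDiamond n).Adj p q) :
    Touches (squareOf p q) p := by
  rw [adj_iff] at h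
  simp only [Touches, squareOf]
  omega

lemma exists_adj_of_touches {e : ℕ × ℕ} {v : AztecVertex n} (he : e ∈ squares n)
    (h : Touches e v) : ∃ u, (aztecDiamond n).Adj v u ∧ squareOf v u = e := by
  rw [mem_squares] at he
  have hv := odd_row_add_col v
  unfold Touches at h
  -- The corner of `e` opposite to `v`: the two rows of a square sum to `2 * e.1 + 1`, and likewise
  -- the columns.
  obtain ⟨u, hr, hc⟩ := exists_vertex (n := n) (r := 2 * e.1 + 1 - v.row)
    (c := 2 * e.2 + 1 - v.col) (by omega) (by omega) (by omega)
  refine ⟨u, ?_, Prod.ext ?_ ?_⟩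
  · rw [adj_iff]; omega
  · simp only [squareOf]; omega
  · simp only [squareOf]; omega

lemma eq_of_squareOf_eq {v u u' : AztecVertex n} (h : (aztecDiamond n).Adj v u)
    (h' : (aztecDiamond n).Adj v u') (hs : squareOf v u = squareOf v u') : u = u' := by
  rw [adj_iff] at h h'
  simp only [squareOf, Prod.mk.injEq] at hs
  exact vertex_ext (by omega) (by omega)

/-- Only one diagonal of a unit square has corners with odd coordinate sum. -/
lemma sym2_eq_of_squareOf_eq {p q p' q' : AztecVertex n} (h : (aztecDiamond n).Adj p q)
    (h' : (aztecDiamond n).Adj p' q') (hs : squareOf p q = squareOf p' q') :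
    s(p, q) = s(p', q') := by
  have h1 := odd_row_add_col p
  have h2 := odd_row_add_col p'
  rw [adj_iff] at h h'
  simp only [squareOf, Prod.mk.injEq] at hs
  rw [Sym2.eq_iff]
  by_cases hr : p.row = p'.row
  · exact Or.inl ⟨vertex_ext hr (by omega), vertex_ext (by omega) (by omega)⟩
  · exact Or.inr ⟨vertex_ext (by omega) (by omega), vertex_ext (by omega) (by omega)⟩

lemma exists_touches {e : ℕ × ℕ} (he : e ∈ squares n) : ∃ v : AztecVertex n, Touches e v := by
  rw [mem_squares] at he
  obtain ⟨u, hr, hc⟩ := exists_vertex (n := n) (r := e.1)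
    (c := if (e.1 + e.2) % 2 = 1 then e.2 else e.2 + 1) (by omega) (by split_ifs <;> omega)
    (by split_ifs <;> omega)
  refine ⟨u, ?_⟩
  unfold Touches
  split_ifs at hc <;> omega

lemma touches_iff_aVertex {e : ℕ × ℕ} {v : AztecVertex n} (h : v.row % 2 = 1) :
    Touches e v ↔ aVertex e = (v.row / 2, v.col / 2) := by
  have := odd_row_add_col v
  simp only [Touches, aVertex, Prod.mk.injEq]
  omega

lemma touches_iff_bVertex {e : ℕ × ℕ} {v : AztecVertex n} (h : v.row % 2 = 0) :
    Touches e v ↔ bVertex e = (v.row / 2, v.col / 2) := by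
  have := odd_row_add_col v
  simp only [Touches, bVertex, Prod.mk.injEq]
  omega

lemma isPerfect_iff {S : Finset (ℕ × ℕ)} :
    IsPerfect n S ↔ ∀ v : AztecVertex n, ∃! e, e ∈ S ∧ Touches e v := by
  have key (P : ℕ × ℕ → Prop) [DecidablePred P] :
      #{e ∈ S | P e} = 1 ↔ ∃! e, e ∈ S ∧ P e := by
    rw [card_eq_one]
    simp only [Finset.ext_iff, mem_filter, mem_singleton, ExistsUnique]
    exact ⟨fun ⟨a, h⟩ => ⟨a, (h a).2 rfl, fun y hy => (h y).1 hy⟩,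
      fun ⟨a, h, h'⟩ => ⟨a, fun y => ⟨h' y, fun hy => hy ▸ h⟩⟩⟩
  constructor
  · rintro ⟨hA, hB⟩ v
    have := row_lt v; have := col_lt v; have := odd_row_add_col v
    rcases Nat.mod_two_eq_zero_or_one v.row with h | h
    · simp only [touches_iff_bVertex h]
      exact (key _).1 (hB _ (by simp only [mem_product, mem_range]; omega))
    · simp only [touches_iff_aVertex h]
      exact (key _).1 (hA _ (by simp only [mem_product, mem_range]; omega))
  · intro H
    constructor
    · rintro ⟨i, j⟩ hp
      simp only [mem_product, mem_range] at hp
      obtain ⟨v, hr, hc⟩ := exists_vertex (n := n) (r := 2 * i + 1) (c := 2 * j)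
        (by omega) (by omega) (by omega)
      have := H v
      simp only [touches_iff_aVertex (v := v) (by omega), hr, hc] at this
      rw [key]
      convert this using 6 <;> omega
    · rintro ⟨i, j⟩ hp
      simp only [mem_product, mem_range] at hp
      obtain ⟨v, hr, hc⟩ := exists_vertex (n := n) (r := 2 * i) (c := 2 * j + 1)
        (by omega) (by omega) (by omega)
      have := H v
      simp only [touches_iff_bVertex (v := v) (by omega), hr, hc] at this
      rw [key]
      convert this using 6 <;> omega

/-- The spanning subgraph of `AD_n` with the edges in the squares of `S`. -/
def toSubgraph (n : ℕ) (S : Finset (ℕ × ℕ)) : (aztecDiamond n).Subgraph where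
  verts := Set.univ
  Adj p q := (aztecDiamond n).Adj p q ∧ squareOf p q ∈ S
  adj_sub h := h.1
  edge_vert _ := Set.mem_univ _
  symm := ⟨fun p q h => ⟨h.1.symm, squareOf_comm p q ▸ h.2⟩⟩

open Classical in
/-- The squares of the edges of a subgraph of `AD_n`. -/
noncomputable def ofSubgraph (M : (aztecDiamond n).Subgraph) : Finset (ℕ × ℕ) :=
  {e ∈ squares n | ∃ p q, M.Adj p q ∧ squareOf p q = e}

lemma mem_ofSubgraph {M : (aztecDiamond n).Subgraph} {e : ℕ × ℕ} :
    e ∈ ofSubgraph M ↔ e ∈ squares n ∧ ∃ p q, M.Adj p q ∧ squareOf p q = e := by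
  simp only [ofSubgraph, mem_filter]

lemma isPerfectMatching_toSubgraph {S : Finset (ℕ × ℕ)} (hS : S ⊆ squares n) :
    (toSubgraph n S).IsPerfectMatching ↔ IsPerfect n S := by
  rw [SimpleGraph.Subgraph.isPerfectMatching_iff, isPerfect_iff]
  refine forall_congr' fun v => ⟨?_, ?_⟩
  · rintro ⟨u, ⟨hu, huS⟩, huniq⟩
    refine ⟨squareOf v u, ⟨huS, touches_squareOf hu⟩, ?_⟩
    rintro e ⟨he, hev⟩
    obtain ⟨u', hu', rfl⟩ := exists_adj_of_touches (hS he) hev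
    rw [huniq u' ⟨hu', he⟩]
  · rintro ⟨e, ⟨he, hev⟩, huniq⟩
    obtain ⟨u, hu, rfl⟩ := exists_adj_of_touches (hS he) hev
    exact ⟨u, ⟨hu, he⟩, fun u' hu' => eq_of_squareOf_eq hu'.1 hu
      (huniq _ ⟨hu'.2, touches_squareOf hu'.1⟩)⟩

lemma toSubgraph_ofSubgraph {M : (aztecDiamond n).Subgraph} (hM : M.IsPerfectMatching) :
    toSubgraph n (ofSubgraph M) = M := by
  refine SimpleGraph.Subgraph.ext ?_ ?_
  · exact (SimpleGraph.Subgraph.isSpanning_iff.1 hM.2).symm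
  · ext p q
    simp only [toSubgraph, mem_ofSubgraph]
    constructor
    · rintro ⟨h, -, p', q', h', hs⟩
      rw [← SimpleGraph.Subgraph.mem_edgeSet, ← sym2_eq_of_squareOf_eq h'.adj_sub h hs]
      exact h'
    · exact fun h => ⟨h.adj_sub, squareOf_mem h.adj_sub, p, q, h, rfl⟩

lemma ofSubgraph_toSubgraph {S : Finset (ℕ × ℕ)} (hS : S ⊆ squares n) :
    ofSubgraph (toSubgraph n S) = S := by
  ext e
  rw [mem_ofSubgraph]
  constructor
  · rintro ⟨-, p, q, h, rfl⟩
    exact h.2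
  · intro he
    obtain ⟨v, hv⟩ := exists_touches (hS he)
    obtain ⟨u, hu, rfl⟩ := exists_adj_of_touches (hS he) hv
    exact ⟨hS he, v, u, ⟨hu, he⟩, rfl⟩

open Classical in
lemma prod_edgeSet (W : ℕ → ℕ → ℝ) {S : Finset (ℕ × ℕ)} (hS : S ⊆ squares n)
    {M : (aztecDiamond n).Subgraph} (hM : toSubgraph n S = M) :
    ∏ e ∈ M.edgeSet.toFinset, aztecWeight n W e = ∏ e ∈ S, W e.1 e.2 := by
  subst hM
  refine prod_bij (fun e _ => Sym2.lift ⟨squareOf, squareOf_comm⟩ e) ?_ ?_ ?_ ?_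
  · intro e
    induction e with | _ p q
    intro h
    exact (Set.mem_toFinset.1 h).2
  · intro e
    induction e with | _ p q
    intro h e'
    induction e' with | _ p' q'
    intro h' hs
    exact sym2_eq_of_squareOf_eq (Set.mem_toFinset.1 h).1 (Set.mem_toFinset.1 h').1 hs
  · intro e he
    obtain ⟨v, hv⟩ := exists_touches (hS he)
    obtain ⟨u, hu, rfl⟩ := exists_adj_of_touches (hS he) hv
    exact ⟨s(v, u), Set.mem_toFinset.2 ⟨hu, he⟩, rfl⟩
  · intro e
    induction e with | _ p q
    intro _
    rfl

open Classical in
lemma gf_eq_sum (n : ℕ) (W : ℕ → ℕ → ℝ) :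
    gf n W = ∑ S ∈ (squares n).powerset with IsPerfect n S, ∏ e ∈ S, W e.1 e.2 := by
  unfold gf matchingGF
  refine sum_nbij' (fun M => ofSubgraph M) (fun S => toSubgraph n S) ?_ ?_ ?_ ?_ ?_
  · intro M hM
    have hM := (mem_filter.1 hM).2
    have hs : ofSubgraph M ⊆ squares n := filter_subset _ _
    refine mem_filter.2 ⟨mem_powerset.2 hs, ?_⟩
    rwa [← isPerfectMatching_toSubgraph hs, toSubgraph_ofSubgraph hM]
  · intro S hS
    rw [mem_filter, mem_powerset] at hS
    rw [mem_filter]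
    exact ⟨@mem_univ _ (_) _, (isPerfectMatching_toSubgraph hS.1).2 hS.2⟩
  · exact fun M hM => toSubgraph_ofSubgraph (mem_filter.1 hM).2
  · exact fun S hS => ofSubgraph_toSubgraph (mem_powerset.1 (mem_filter.1 hS).1)
  · intro M hM
    have hM := (mem_filter.1 hM).2
    have hs : ofSubgraph M ⊆ squares n := filter_subset _ _
    exact prod_edgeSet W hs (toSubgraph_ofSubgraph hM)

lemma gf_congr {W W' : ℕ → ℕ → ℝ} (h : ∀ r < 2 * n, ∀ c < 2 * n, W r c = W' r c) :
    gf n W = gf n W' := by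
  classical
  rw [gf_eq_sum, gf_eq_sum]
  refine sum_congr rfl fun S hS => prod_congr rfl fun e he => ?_
  have := mem_squares.1 (mem_powerset.1 (mem_filter.1 hS).1 he)
  exact h _ this.1 _ this.2

lemma gf_zero (W : ℕ → ℕ → ℝ) : gf 0 W = 1 := by
  classical
  have h : IsPerfect 0 ∅ := by simp [IsPerfect]
  rw [gf_eq_sum]
  simp [squares, filter_singleton, h]

/-- Multiplying the weights of all edges at the vertices of the `j`-th even column by `l j`. -/
lemma gf_mul_column (W : ℕ → ℕ → ℝ) (l : ℕ → ℝ) :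
    gf n (fun r c => W r c * l ((c + 1) / 2)) = (∏ j ∈ range (n + 1), l j) ^ n * gf n W := by
  classical
  rw [gf_eq_sum, gf_eq_sum, mul_sum]
  refine sum_congr rfl fun S hS => ?_
  obtain ⟨hs, hA, -⟩ := mem_filter.1 hS
  rw [prod_mul_distrib, mul_comm]
  congr 1
  have : ∏ p ∈ range n ×ˢ range (n + 1), l p.2 = (∏ j ∈ range (n + 1), l j) ^ n := by
    rw [prod_product]; simp
  rw [← this]
  -- Each edge has exactly one end in an even column, so a perfect matching is in bijection with
  -- those vertices, `n` in each of the `n + 1` columns.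
  refine prod_bij (fun e _ => aVertex e) ?_ ?_ ?_ (fun _ _ => rfl)
  · intro e he
    have := mem_squares.1 (mem_powerset.1 hs he)
    simp only [aVertex, mem_product, mem_range]
    omega
  · intro e he e' he' h
    have hm := mem_squares.1 (mem_powerset.1 hs he)
    have := hA (aVertex e) (by simp only [aVertex, mem_product, mem_range]; omega)
    exact card_le_one.1 this.le e (by simp [he]) e' (by simp [he', h])
  · intro p hp
    obtain ⟨e, he⟩ := card_pos.1 (by rw [hA p hp]; exact one_pos)
    exact ⟨e, (mem_filter.1 he).1, (mem_filter.1 he).2⟩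

end AztecSquares

/-! ### Factorization of the matching sum over blocks -/

namespace AztecSquares

open Finset

/-- The four unit squares around the point `(2i + 1, 2j + 1)`, for `c = (i, j)`. -/
def block (c : ℕ × ℕ) : Finset (ℕ × ℕ) :=
  {2 * c.1, 2 * c.1 + 1} ×ˢ {2 * c.2, 2 * c.2 + 1}

lemma mem_block {c e : ℕ × ℕ} : e ∈ block c ↔ e.1 / 2 = c.1 ∧ e.2 / 2 = c.2 := by
  simp only [block, mem_product, mem_insert, mem_singleton]
  omega

/-- `T` covers the left, right, top and bottom vertices of a block as `l`, `r`, `t`, `b` say. -/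
def Covers (T : Finset (ℕ × ℕ)) (l r t b : Bool) : Prop :=
  (#{e ∈ T | e.2 % 2 = 0} = l.toNat ∧ #{e ∈ T | e.2 % 2 = 1} = r.toNat) ∧
    #{e ∈ T | e.1 % 2 = 0} = t.toNat ∧ #{e ∈ T | e.1 % 2 = 1} = b.toNat

instance (T : Finset (ℕ × ℕ)) (l r t b : Bool) : Decidable (Covers T l r t b) :=
  inferInstanceAs (Decidable (_ ∧ _))

/-- The generating function of the matchings of a block that cover exactly the given vertices. -/
def blockGF (W : ℕ → ℕ → ℝ) (c : ℕ × ℕ) (l r t b : Bool) : ℝ :=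
  ∑ T ∈ (block c).powerset, if Covers T l r t b then ∏ e ∈ T, W e.1 e.2 else 0

/-- The generating function of all matchings of the 4-cycle of a block that cover its vertices. -/
def blockFactor (W : ℕ → ℕ → ℝ) (i j : ℕ) : ℝ :=
  W (2 * i) (2 * j) * W (2 * i + 1) (2 * j + 1) + W (2 * i) (2 * j + 1) * W (2 * i + 1) (2 * j)

lemma blockGF_eq (W : ℕ → ℕ → ℝ) (i j : ℕ) (l r t b : Bool) :
    blockGF W (i, j) l r t b = match l, r, t, b with
      | false, false, false, false => 1
      | true, false, true, false => W (2 * i) (2 * j)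
      | false, true, true, false => W (2 * i) (2 * j + 1)
      | true, false, false, true => W (2 * i + 1) (2 * j)
      | false, true, false, true => W (2 * i + 1) (2 * j + 1)
      | true, true, true, true => blockFactor W i j
      | _, _, _, _ => 0 := by
  have hb : block (i, j) = insert (2 * i, 2 * j) (insert (2 * i, 2 * j + 1)
      (insert (2 * i + 1, 2 * j) {(2 * i + 1, 2 * j + 1)})) := by
    ext e
    simp only [mem_block, mem_insert, mem_singleton, Prod.ext_iff]
    omega
  have m (k : ℕ) : (2 * k + 1) % 2 = 1 := by omega
  unfold blockGF
  rw [hb]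
  rw [sum_powerset_insert (by simp), sum_powerset_insert (by simp), sum_powerset_insert (by simp),
    sum_powerset_insert (by simp), sum_powerset_insert (by simp), sum_powerset_insert (by simp),
    sum_powerset_insert (by simp)]
  have hs (f : Finset (ℕ × ℕ) → ℝ) (x : ℕ × ℕ) : ∑ T ∈ powerset {x}, f T = f ∅ + f {x} := by
    rw [← insert_empty_eq, sum_powerset_insert (by simp)]
    simp
  simp only [hs, Covers, filter_insert, filter_singleton, filter_empty, m, insert_empty_eq]
  cases l <;> cases r <;> cases t <;> cases b <;> simp [blockFactor]
  ring

/-- Distributivity: a subset of a disjoint union is an independent choice of a subset of each part.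
-/
lemma sum_powerset_biUnion {ι α : Type*} [DecidableEq ι] [DecidableEq α] (I : Finset ι)
    (t : ι → Finset α) (ht : ∀ i j, i ≠ j → Disjoint (t i) (t j)) (g : ι → Finset α → ℝ) :
    ∑ S ∈ (I.biUnion t).powerset, ∏ i ∈ I, g i (S ∩ t i) =
      ∏ i ∈ I, ∑ T ∈ (t i).powerset, g i T := by
  induction I using Finset.induction_on with
  | empty => simp
  | insert a I ha ih =>
    have hd : Disjoint (t a) (I.biUnion t) := by
      rw [disjoint_biUnion_right]
      exact fun j hj => ht _ _ (fun h => ha (h ▸ hj))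
    rw [prod_insert ha, ← ih, sum_mul_sum, ← sum_product', biUnion_insert]
    refine sum_nbij' (fun S => (S ∩ t a, S ∩ I.biUnion t)) (fun P => P.1 ∪ P.2) ?_ ?_ ?_ ?_ ?_
    · intro S _
      simp [inter_subset_right]
    · rintro ⟨P, Q⟩ h
      simp only [mem_product, mem_powerset] at h ⊢
      exact union_subset_union h.1 h.2
    · intro S hS
      rw [mem_powerset] at hS
      rw [← inter_union_distrib_left, inter_eq_left.2 hS]
    · rintro ⟨P, Q⟩ h
      simp only [mem_product, mem_powerset] at h
      have h1 : Q ∩ t a = ∅ := disjoint_iff_inter_eq_empty.1 (hd.symm.mono_left h.2)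
      have h2 : P ∩ I.biUnion t = ∅ := disjoint_iff_inter_eq_empty.1 (hd.mono_left h.1)
      simp only [union_inter_distrib_right, h1, h2, inter_eq_left.2 h.1, inter_eq_left.2 h.2,
        union_empty, empty_union]
    · intro S _
      rw [prod_insert ha]
      congr 1
      refine prod_congr rfl fun i hi => ?_
      rw [inter_assoc, inter_eq_right.2 (subset_biUnion_of_mem t hi)]

/-- The edges in `S` cover every vertex of `AD_N` inside the grid once; those on the boundary of the
grid are left uncovered if `b` is true, and covered once otherwise. -/
def IsPerfectOn (b : Bool) (N : ℕ) (S : Finset (ℕ × ℕ)) : Prop :=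
  (∀ i < N, ∀ j < N + 1, #{e ∈ S | aVertex e = (i, j)} =
      if j = 0 ∨ j = N then (!b).toNat else 1) ∧
    ∀ j < N, ∀ i < N + 1, #{e ∈ S | bVertex e = (i, j)} =
      if i = 0 ∨ i = N then (!b).toNat else 1

/-- For every vertex, whether it is covered by the block on its right (or below it). Boundary
vertices count as covered from outside if `b` is true. -/
structure IsBoundary (b : Bool) {N : ℕ} (h v : Fin N → Fin (N + 1) → Bool) : Prop where
  left : ∀ i, h i 0 = !b
  right : ∀ i, h i (Fin.last N) = b
  top : ∀ j, v j 0 = !b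
  bottom : ∀ j, v j (Fin.last N) = b

lemma bool_toNat_not (x : Bool) : (!x).toNat = 1 - x.toNat := by cases x <;> rfl

/-- One line of `N` blocks and the `N + 1` vertices between and around them. `post j` counts the
edges of block `j` at vertex `j`, `pre j` those at vertex `j + 1`. An inner vertex is covered once
iff exactly one of its two neighbouring blocks covers it, and `h` records whether that is the later
one. -/
lemma exists_state_iff {N : ℕ} (hN : 0 < N) (b : Bool) (post pre cnt : ℕ → ℕ)
    (hcnt : ∀ j < N + 1, cnt j =
      (if j = N then 0 else post j) + (if j = 0 then 0 else pre (j - 1))) :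
    (∀ j < N + 1, cnt j = if j = 0 ∨ j = N then (!b).toNat else 1) ↔
      ∃ h : Fin (N + 1) → Bool, (h 0 = !b ∧ h (Fin.last N) = b) ∧
        ∀ j : Fin N, post j = (h j.castSucc).toNat ∧ pre j = (!h j.succ).toNat := by
  constructor
  · intro H
    have key : ∀ j < N + 1, (if j = N then 0 else post j) + (if j = 0 then 0 else pre (j - 1)) =
        if j = 0 ∨ j = N then (!b).toNat else 1 := fun j hj => (hcnt j hj).symm.trans (H j hj)
    have hb : b.toNat ≤ 1 := Bool.toNat_le b
    -- No block follows vertex `N`, so its value is the prescribed boundary value.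
    refine ⟨fun j => if (j : ℕ) = N then b else decide (post j = 1), ⟨?_, ?_⟩, fun j => ⟨?_, ?_⟩⟩
    · have := key 0 (by omega)
      simp only [hN.ne, if_false, if_true, true_or, add_zero] at this
      simp only [Fin.val_zero, hN.ne, if_false, this]
      cases b <;> rfl
    · simp
    · have := key j (by omega)
      have hj := j.2
      simp only [hj.ne, if_false, or_false] at this
      simp only [Fin.val_castSucc, hj.ne, if_false]
      rw [bool_toNat_not] at this
      by_cases h1 : post j = 1
      · simp [h1]
      · have : post j = 0 := by split_ifs at this <;> omega
        simp [this]
    · have := key (j + 1) (by omega)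
      simp only [Nat.succ_ne_zero, if_false, false_or, Nat.add_sub_cancel] at this
      simp only [Fin.val_succ]
      split_ifs at this ⊢ with h1
      · simpa using this
      · by_cases h2 : post (j + 1) = 1
        · have : pre j = 0 := by omega
          simp [h2, this]
        · have : pre j = 1 := by omega
          simp [h2, this]
  · rintro ⟨h, ⟨h0, hl⟩, hh⟩ j hj
    have hpost : (if j = N then 0 else post j) =
        if j = N then 0 else (h ⟨j, hj⟩).toNat := by
      split_ifs with h1
      · rfl
      · exact (hh ⟨j, by omega⟩).1
    have hpre : (if j = 0 then 0 else pre (j - 1)) =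
        if j = 0 then 0 else (!h ⟨j, hj⟩).toNat := by
      split_ifs with h1
      · rfl
      · rw [(hh ⟨j - 1, by omega⟩).2]
        congr 3
        exact Fin.ext (by simp only [Fin.val_succ]; omega)
    rw [hcnt j hj, hpost, hpre]
    rcases Nat.eq_zero_or_pos j with rfl | hj0
    · simp [hN.ne, h0]
    · by_cases hjN : j = N
      · subst hjN
        have : h ⟨j, hj⟩ = b := hl
        simp [hN.ne', this]
      · simp only [hjN, hj0.ne', if_false, or_self, bool_toNat_not]
        have := Bool.toNat_le (h ⟨j, hj⟩)
        omega

lemma card_filter_aVertex {N : ℕ} {S : Finset (ℕ × ℕ)} (hS : S ⊆ squares N) (i j : ℕ) :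
    #{e ∈ S | aVertex e = (i, j)} =
      (if j = N then 0 else #{e ∈ S ∩ block (i, j) | e.2 % 2 = 0}) +
        (if j = 0 then 0 else #{e ∈ S ∩ block (i, j - 1) | e.2 % 2 = 1}) := by
  rw [← card_filter_add_card_filter_not (fun e : ℕ × ℕ => e.2 % 2 = 0)]
  congr 1
  · split_ifs with h
    · rw [card_eq_zero, filter_eq_empty_iff]
      intro e he
      obtain ⟨he, h1⟩ := mem_filter.1 he
      have := mem_squares.1 (hS he)
      simp only [aVertex, Prod.mk.injEq] at h1
      omega
    · congr 1
      ext e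
      simp only [mem_filter, mem_inter, mem_block, aVertex, Prod.mk.injEq, and_assoc]
      refine and_congr_right fun _ => ?_
      omega
  · split_ifs with h
    · rw [card_eq_zero, filter_eq_empty_iff]
      intro e he
      obtain ⟨he, h1⟩ := mem_filter.1 he
      simp only [aVertex, Prod.mk.injEq] at h1
      omega
    · congr 1
      ext e
      simp only [mem_filter, mem_inter, mem_block, aVertex, Prod.mk.injEq, and_assoc]
      refine and_congr_right fun _ => ?_
      omega

lemma card_filter_bVertex {N : ℕ} {S : Finset (ℕ × ℕ)} (hS : S ⊆ squares N) (j i : ℕ) :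
    #{e ∈ S | bVertex e = (i, j)} =
      (if i = N then 0 else #{e ∈ S ∩ block (i, j) | e.1 % 2 = 0}) +
        (if i = 0 then 0 else #{e ∈ S ∩ block (i - 1, j) | e.1 % 2 = 1}) := by
  rw [← card_filter_add_card_filter_not (fun e : ℕ × ℕ => e.1 % 2 = 0)]
  congr 1
  · split_ifs with h
    · rw [card_eq_zero, filter_eq_empty_iff]
      intro e he
      obtain ⟨he, h1⟩ := mem_filter.1 he
      have := mem_squares.1 (hS he)
      simp only [bVertex, Prod.mk.injEq] at h1
      omega
    · congr 1
      ext e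
      simp only [mem_filter, mem_inter, mem_block, bVertex, Prod.mk.injEq, and_assoc]
      refine and_congr_right fun _ => ?_
      omega
  · split_ifs with h
    · rw [card_eq_zero, filter_eq_empty_iff]
      intro e he
      obtain ⟨he, h1⟩ := mem_filter.1 he
      simp only [bVertex, Prod.mk.injEq] at h1
      omega
    · congr 1
      ext e
      simp only [mem_filter, mem_inter, mem_block, bVertex, Prod.mk.injEq, and_assoc]
      refine and_congr_right fun _ => ?_
      omega

/-- The edges in `S` cover the vertices as the state `(h, v)` says. -/
def IsState (b : Bool) {N : ℕ} (S : Finset (ℕ × ℕ)) (h v : Fin N → Fin (N + 1) → Bool) : Prop :=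
  IsBoundary b h v ∧ ∀ i j : Fin N, Covers (S ∩ block (i, j))
    (h i j.castSucc) (!h i j.succ) (v j i.castSucc) (!v j i.succ)

lemma isPerfectOn_iff {N : ℕ} (hN : 0 < N) (b : Bool) {S : Finset (ℕ × ℕ)}
    (hS : S ⊆ squares N) :
    IsPerfectOn b N S ↔ ∃ h v : Fin N → Fin (N + 1) → Bool, IsState b S h v := by
  have hA (i : ℕ) := exists_state_iff hN b (fun j => #{e ∈ S ∩ block (i, j) | e.2 % 2 = 0})
    (fun j => #{e ∈ S ∩ block (i, j) | e.2 % 2 = 1}) (fun j => #{e ∈ S | aVertex e = (i, j)})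
    (fun j _ => card_filter_aVertex hS i j)
  have hB (j : ℕ) := exists_state_iff hN b (fun i => #{e ∈ S ∩ block (i, j) | e.1 % 2 = 0})
    (fun i => #{e ∈ S ∩ block (i, j) | e.1 % 2 = 1}) (fun i => #{e ∈ S | bVertex e = (i, j)})
    (fun i _ => card_filter_bVertex hS j i)
  constructor
  · rintro ⟨h1, h2⟩
    choose h hh using fun i : Fin N => (hA i).1 (h1 i i.2)
    choose v hv using fun j : Fin N => (hB j).1 (h2 j j.2)
    exact ⟨h, v, ⟨fun i => (hh i).1.1, fun i => (hh i).1.2, fun j => (hv j).1.1,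
      fun j => (hv j).1.2⟩, fun i j => ⟨(hh i).2 j, (hv j).2 i⟩⟩
  · rintro ⟨h, v, hb, hc⟩
    exact ⟨fun i hi => (hA i).2 ⟨h ⟨i, hi⟩, ⟨hb.left _, hb.right _⟩, fun j => (hc ⟨i, hi⟩ j).1⟩,
      fun j hj => (hB j).2 ⟨v ⟨j, hj⟩, ⟨hb.top _, hb.bottom _⟩, fun i => (hc i ⟨j, hj⟩).2⟩⟩

lemma toNat_inj {x y : Bool} (h : x.toNat = y.toNat) : x = y := by
  cases x <;> cases y <;> simp_all

/-- The counts in `S` fix the state at every vertex that has a block after it; the boundary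
condition fixes the last one. -/
lemma IsState.unique {N : ℕ} {b : Bool} {S : Finset (ℕ × ℕ)}
    {h v h' v' : Fin N → Fin (N + 1) → Bool} (H : IsState b S h v) (H' : IsState b S h' v') :
    (h, v) = (h', v') := by
  refine Prod.ext (funext fun i => funext fun j => ?_) (funext fun i => funext fun j => ?_)
  · refine Fin.lastCases ?_ (fun j => ?_) j
    · exact (H.1.right i).trans (H'.1.right i).symm
    · exact toNat_inj ((H.2 i j).1.1.symm.trans (H'.2 i j).1.1)
  · refine Fin.lastCases ?_ (fun j => ?_) j
    · exact (H.1.bottom i).trans (H'.1.bottom i).symm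
    · exact toNat_inj ((H.2 j i).2.1.symm.trans (H'.2 j i).2.1)

open Classical in
lemma sum_isState {N : ℕ} (hN : 0 < N) (b : Bool) {S : Finset (ℕ × ℕ)} (hS : S ⊆ squares N)
    (x : ℝ) :
    ∑ s : (Fin N → Fin (N + 1) → Bool) × (Fin N → Fin (N + 1) → Bool),
      (if IsState b S s.1 s.2 then x else 0) = if IsPerfectOn b N S then x else 0 := by
  split_ifs with h
  · obtain ⟨h, v, H⟩ := (isPerfectOn_iff hN b hS).1 h
    rw [sum_eq_single (h, v)]
    · rw [if_pos H]
    · exact fun s _ hs => if_neg fun H' => hs (H'.unique H)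
    · simp
  · exact sum_eq_zero fun s _ =>
      if_neg fun H => h ((isPerfectOn_iff hN b hS).2 ⟨s.1, s.2, H⟩)

lemma biUnion_block (N : ℕ) :
    (univ : Finset (Fin N × Fin N)).biUnion (fun c => block (c.1, c.2)) = squares N := by
  ext e
  simp only [mem_biUnion, mem_univ, true_and, mem_block, mem_squares]
  constructor
  · rintro ⟨⟨i, j⟩, h⟩
    simp only at h
    omega
  · intro h
    exact ⟨(⟨e.1 / 2, by omega⟩, ⟨e.2 / 2, by omega⟩), rfl, rfl⟩

lemma disjoint_block {N : ℕ} (c c' : Fin N × Fin N) (h : c ≠ c') :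
    Disjoint (block (c.1, c.2)) (block (c'.1, c'.2)) := by
  rw [disjoint_left]
  intro e he he'
  rw [mem_block] at he he'
  exact h (Prod.ext (Fin.ext (he.1.symm.trans he'.1)) (Fin.ext (he.2.symm.trans he'.2)))

lemma prod_inter_block {N : ℕ} (W : ℕ → ℕ → ℝ) {S : Finset (ℕ × ℕ)} (hS : S ⊆ squares N) :
    ∏ c : Fin N × Fin N, ∏ e ∈ S ∩ block (c.1, c.2), W e.1 e.2 = ∏ e ∈ S, W e.1 e.2 := by
  rw [← prod_biUnion, ← inter_biUnion, biUnion_block, inter_eq_left.2 hS]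
  exact fun c _ c' _ h => (disjoint_block c c' h).mono inter_subset_right inter_subset_right

open Classical in
/-- The sum over all perfect matchings factors, state by state, over the blocks. -/
lemma sum_isPerfectOn {N : ℕ} (hN : 0 < N) (b : Bool) (W : ℕ → ℕ → ℝ) :
    ∑ S ∈ (squares N).powerset with IsPerfectOn b N S, ∏ e ∈ S, W e.1 e.2 =
      ∑ s : (Fin N → Fin (N + 1) → Bool) × (Fin N → Fin (N + 1) → Bool),
        if IsBoundary b s.1 s.2 then
          ∏ c : Fin N × Fin N, blockGF W (c.1, c.2) (s.1 c.1 c.2.castSucc) (!s.1 c.1 c.2.succ)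
            (s.2 c.2 c.1.castSucc) (!s.2 c.2 c.1.succ)
        else 0 := by
  rw [sum_filter, sum_congr rfl fun S hS => (sum_isState hN b (mem_powerset.1 hS) _).symm,
    sum_comm]
  refine sum_congr rfl fun s _ => ?_
  split_ifs with hb
  · simp only [blockGF]
    rw [← sum_powerset_biUnion univ (fun c : Fin N × Fin N => block (c.1, c.2)) disjoint_block
      (fun c T => if Covers T (s.1 c.1 c.2.castSucc) (!s.1 c.1 c.2.succ)
            (s.2 c.2 c.1.castSucc) (!s.2 c.2 c.1.succ) then ∏ e ∈ T, W e.1 e.2 else 0),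
      biUnion_block]
    refine sum_congr rfl fun S hS => ?_
    rw [← prod_inter_block W (mem_powerset.1 hS)]
    split_ifs with H
    · exact prod_congr rfl fun c _ => (if_pos (H.2 c.1 c.2)).symm
    · simp only [IsState, hb, true_and, not_forall] at H
      obtain ⟨i, j, h⟩ := H
      exact (prod_eq_zero (mem_univ (i, j)) (if_neg h)).symm
  · exact sum_eq_zero fun S _ => if_neg fun H => hb H.1

end AztecSquares

/-! ### Urban renewal from order `n + 1` to order `n` -/

namespace AztecSquares

open Finset

variable {n : ℕ}

lemma isPerfectOn_false {S : Finset (ℕ × ℕ)} : IsPerfectOn false n S ↔ IsPerfect n S := by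
  simp only [IsPerfectOn, IsPerfect, Bool.not_false, Bool.toNat_true, ite_self, Prod.forall,
    mem_product, mem_range, and_imp]
  exact and_congr (by tauto) ⟨fun h i j hi hj => h j hj i hi, fun h j hj i hi => h i j hi hj⟩

/-- The diagonal unit shift, which puts the squares of `AD_n` in the middle of those of
`AD_{n+1}`. -/
def shift : ℕ × ℕ ↪ ℕ × ℕ :=
  ⟨fun e => (e.1 + 1, e.2 + 1), fun e e' h => by
    simp only [Prod.mk.injEq] at h
    exact Prod.ext (by omega) (by omega)⟩

@[simp] lemma shift_apply (e : ℕ × ℕ) : shift e = (e.1 + 1, e.2 + 1) := rfl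

/-- The diagonal shift changes both parities, so it exchanges the two classes of vertices. -/
lemma card_aVertex_shift (S : Finset (ℕ × ℕ)) (i j : ℕ) :
    #{e ∈ S.map shift | aVertex e = (i, j + 1)} = #{e ∈ S | bVertex e = (i, j)} := by
  rw [filter_map, card_map]
  congr 1
  refine filter_congr fun e _ => ?_
  simp only [Function.comp, shift_apply, aVertex, bVertex, Prod.mk.injEq]
  omega

lemma card_bVertex_shift (S : Finset (ℕ × ℕ)) (i j : ℕ) :
    #{e ∈ S.map shift | bVertex e = (i + 1, j)} = #{e ∈ S | aVertex e = (i, j)} := by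
  rw [filter_map, card_map]
  congr 1
  refine filter_congr fun e _ => ?_
  simp only [Function.comp, shift_apply, aVertex, bVertex, Prod.mk.injEq]
  omega

lemma isPerfectOn_true_shift {S : Finset (ℕ × ℕ)} (hS : S ⊆ squares n) :
    IsPerfectOn true (n + 1) (S.map shift) ↔ IsPerfect n S := by
  have hm : ∀ e ∈ S.map shift, 0 < e.1 ∧ 0 < e.2 ∧ e.1 < 2 * n + 1 ∧ e.2 < 2 * n + 1 := by
    intro e he
    obtain ⟨a, ha, rfl⟩ := mem_map.1 he
    have := mem_squares.1 (hS ha)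
    simp only [shift_apply]
    omega
  simp only [IsPerfectOn, IsPerfect, Bool.not_true, Bool.toNat_false, Prod.forall,
    mem_product, mem_range, and_imp]
  constructor
  · rintro ⟨hA, hB⟩
    refine ⟨fun i j hi hj => ?_, fun i j hi hj => ?_⟩
    · rw [← card_bVertex_shift, hB j hj (i + 1) (by omega), if_neg (by omega)]
    · rw [← card_aVertex_shift, hA i hi (j + 1) (by omega), if_neg (by omega)]
  · rintro ⟨hA, hB⟩
    refine ⟨fun i hi j hj => ?_, fun j hj i hi => ?_⟩
    · split_ifs with h
      · rw [card_eq_zero, filter_eq_empty_iff]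
        intro e he h'
        have := hm e he
        simp only [aVertex, Prod.mk.injEq] at h'
        omega
      · obtain ⟨j, rfl⟩ := Nat.exists_eq_succ_of_ne_zero (show j ≠ 0 by omega)
        rw [Nat.succ_eq_add_one, card_aVertex_shift, hB i j hi (by omega)]
    · split_ifs with h
      · rw [card_eq_zero, filter_eq_empty_iff]
        intro e he h'
        have := hm e he
        simp only [bVertex, Prod.mk.injEq] at h'
        omega
      · obtain ⟨i, rfl⟩ := Nat.exists_eq_succ_of_ne_zero (show i ≠ 0 by omega)
        rw [Nat.succ_eq_add_one, card_bVertex_shift, hA i j (by omega) hj]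

/-- A square in an outermost row or column has its edge end on the boundary of the grid, where
nothing may be covered. -/
lemma exists_shift_of_isPerfectOn_true {S : Finset (ℕ × ℕ)} (hS : S ⊆ squares (n + 1))
    (h : IsPerfectOn true (n + 1) S) : ∃ T ⊆ squares n, T.map shift = S := by
  suffices hm : ∀ e ∈ S, 0 < e.1 ∧ 0 < e.2 ∧ e.1 < 2 * n + 1 ∧ e.2 < 2 * n + 1 by
    refine ⟨{e ∈ squares n | shift e ∈ S}, filter_subset _ _, ?_⟩
    ext e
    simp only [mem_map, mem_filter, mem_squares]
    constructor
    · rintro ⟨a, ⟨-, ha⟩, rfl⟩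
      exact ha
    · intro he
      have := hm e he
      have hs : shift (e.1 - 1, e.2 - 1) = e := Prod.ext
        (by simp only [shift_apply]; omega) (by simp only [shift_apply]; omega)
      exact ⟨(e.1 - 1, e.2 - 1), ⟨by simp only; omega, hs.symm ▸ he⟩, hs⟩
  intro e he
  have hs := mem_squares.1 (hS he)
  have hA := h.1 (e.1 / 2) (by omega) ((e.2 + 1) / 2) (by omega)
  have hB := h.2 (e.2 / 2) (by omega) ((e.1 + 1) / 2) (by omega)
  have hA' : 0 < #{x ∈ S | aVertex x = (e.1 / 2, (e.2 + 1) / 2)} :=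
    card_pos.2 ⟨e, mem_filter.2 ⟨he, rfl⟩⟩
  have hB' : 0 < #{x ∈ S | bVertex x = ((e.1 + 1) / 2, e.2 / 2)} :=
    card_pos.2 ⟨e, mem_filter.2 ⟨he, rfl⟩⟩
  simp only [Bool.not_true, Bool.toNat_false] at hA hB
  split_ifs at hA hB <;> omega

open Classical in
lemma gf_shift (W : ℕ → ℕ → ℝ) : gf n (fun r c => W (r + 1) (c + 1)) =
    ∑ S ∈ (squares (n + 1)).powerset with IsPerfectOn true (n + 1) S, ∏ e ∈ S, W e.1 e.2 := by
  rw [gf_eq_sum]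
  refine sum_bij (fun S _ => S.map shift) ?_ ?_ ?_ ?_
  · intro S hS
    rw [mem_filter, mem_powerset] at hS ⊢
    refine ⟨fun e he => ?_, (isPerfectOn_true_shift hS.1).2 hS.2⟩
    obtain ⟨a, ha, rfl⟩ := mem_map.1 he
    have := mem_squares.1 (hS.1 ha)
    simp only [mem_squares, shift_apply]
    omega
  · exact fun S _ T _ h => map_injective shift h
  · intro S hS
    rw [mem_filter, mem_powerset] at hS
    obtain ⟨T, hT, rfl⟩ := exists_shift_of_isPerfectOn_true hS.1 hS.2
    exact ⟨T, by rw [mem_filter, mem_powerset]; exact ⟨hT, (isPerfectOn_true_shift hT).1 hS.2⟩, rfl⟩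
  · intro S _
    rw [prod_map]
    rfl

/-- The weights after urban renewal in every block: each edge gets the weight of the opposite edge
of its block, divided by the factor of the block. -/
noncomputable def renewal (W : ℕ → ℕ → ℝ) (r c : ℕ) : ℝ :=
  W (2 * (r / 2) + 1 - r % 2) (2 * (c / 2) + 1 - c % 2) / blockFactor W (r / 2) (c / 2)

/-- The edge opposite to a given one covers exactly the other two vertices. The empty and the full
coverage correspond because the renewed factor is the inverse of the old one (`hf`). -/
lemma blockGF_renewal {W : ℕ → ℕ → ℝ} {i j : ℕ} (h : blockFactor W i j ≠ 0) (l r t b : Bool) :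
    blockGF W (i, j) l r t b =
      blockFactor W i j * blockGF (renewal W) (i, j) (!l) (!r) (!t) (!b) := by
  have e1 (k : ℕ) : 2 * k / 2 = k := by omega
  have e2 (k : ℕ) : (2 * k + 1) / 2 = k := by omega
  have e3 (k : ℕ) : 2 * k % 2 = 0 := by omega
  have e4 (k : ℕ) : (2 * k + 1) % 2 = 1 := by omega
  have hf : blockFactor W i j * blockFactor (renewal W) i j = 1 := by
    unfold blockFactor at h ⊢
    simp only [renewal, blockFactor, e1, e2, e3, e4, Nat.sub_zero, Nat.add_sub_cancel]
    field_simp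
  rw [blockGF_eq, blockGF_eq]
  cases l <;> cases r <;> cases t <;> cases b <;>
    simp only [Bool.not_true, Bool.not_false, mul_zero, mul_one, hf, renewal, e1, e2, e3, e4,
      Nat.sub_zero, Nat.add_sub_cancel, mul_div_cancel₀ _ h]

lemma isBoundary_not {N : ℕ} {b : Bool} {h v : Fin N → Fin (N + 1) → Bool} :
    IsBoundary (!b) (fun i j => !h i j) (fun i j => !v i j) ↔ IsBoundary b h v := by
  constructor
  · rintro ⟨h1, h2, h3, h4⟩
    simp only [Bool.not_inj_iff] at h1 h2 h3 h4
    exact ⟨h1, h2, h3, h4⟩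
  · rintro ⟨h1, h2, h3, h4⟩
    exact ⟨fun i => by rw [h1], fun i => by rw [h2], fun i => by rw [h3], fun i => by rw [h4]⟩

/-- Urban renewal in all blocks of `AD_{n+1}` at once. -/
theorem gf_succ (W : ℕ → ℕ → ℝ) (h : ∀ i < n + 1, ∀ j < n + 1, blockFactor W i j ≠ 0) :
    gf (n + 1) W = (∏ i ∈ range (n + 1), ∏ j ∈ range (n + 1), blockFactor W i j) *
      gf n (fun r c => renewal W (r + 1) (c + 1)) := by
  classical
  rw [gf_shift, gf_eq_sum]
  simp only [← isPerfectOn_false]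
  rw [sum_isPerfectOn n.succ_pos, sum_isPerfectOn n.succ_pos, mul_sum]
  -- Reindexing by the complementary state turns the boundary condition `false` into `true`.
  have hinv : Function.Involutive
      (fun s : (Fin (n + 1) → Fin (n + 1 + 1) → Bool) × (Fin (n + 1) → Fin (n + 1 + 1) → Bool) =>
        ((fun i j => !s.1 i j, fun i j => !s.2 i j) :
          (Fin (n + 1) → Fin (n + 1 + 1) → Bool) × (Fin (n + 1) → Fin (n + 1 + 1) → Bool))) := by
    intro s
    simp
  rw [← Equiv.sum_comp hinv.toPerm (fun s => _ * _)]
  refine sum_congr rfl fun s _ => ?_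
  simp only [Function.Involutive.coe_toPerm]
  have hb := isBoundary_not (b := false) (h := s.1) (v := s.2)
  rw [Bool.not_false] at hb
  simp only [hb]
  split_ifs with hbd
  · rw [prod_range, prod_congr rfl fun i _ => prod_range _, ← Fintype.prod_prod_type',
      ← prod_mul_distrib]
    exact prod_congr rfl fun c _ => blockGF_renewal (h c.1 c.1.2 c.2 c.2.2) _ _ _ _
  · rw [mul_zero]

end AztecSquares

/-! ### The four-row pattern under two renewals -/

namespace AztecSquares

open Finset

/-- The infinite array with rows `a b a b …`, `a b a b …`, `c d c d …`, `c d c d …`, repeated. -/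
def pattern (a b c d : ℕ → ℝ) (r s : ℕ) : ℝ :=
  if r % 4 < 2 then
    if s % 2 = 0 then a (s / 2 + 1) else b (s / 2 + 1)
  else
    if s % 2 = 0 then c (s / 2 + 1) else d (s / 2 + 1)

variable {a b c d : ℕ → ℝ}

lemma blockFactor_pattern (i j : ℕ) : blockFactor (pattern a b c d) i j =
    if i % 2 = 0 then 2 * (a (j + 1) * b (j + 1)) else 2 * (c (j + 1) * d (j + 1)) := by
  have e1 : 2 * j / 2 = j := by omega
  have e2 : (2 * j + 1) / 2 = j := by omega
  have e3 : 2 * j % 2 = 0 := by omega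
  have e4 : (2 * j + 1) % 2 = 1 := by omega
  simp only [blockFactor, pattern, e1, e2, e3, e4, if_true, one_ne_zero, if_false]
  split_ifs <;> first | omega | ring

/-- The factor of the `j`-th column of blocks after one renewal step. -/
noncomputable def columnFactor (a b c d : ℕ → ℝ) (j : ℕ) : ℝ :=
  (b (j + 1) * c (j + 2))⁻¹ + (a (j + 2) * d (j + 1))⁻¹

/-- The pattern after one renewal step. -/
noncomputable def midPattern (a b c d : ℕ → ℝ) (r s : ℕ) : ℝ :=
  pattern (fun j => (b j)⁻¹) (fun j => (a (j + 1))⁻¹) (fun j => (d j)⁻¹) (fun j => (c (j + 1))⁻¹)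
    (r + 1) s

/-- After the diagonal shift each block has one row from `a, b` and one from `c, d`. Their order
alternates with `i`, but exchanging the rows preserves the factor. -/
lemma blockFactor_midPattern (i j : ℕ) :
    blockFactor (midPattern a b c d) i j = columnFactor a b c d j := by
  have e1 : 2 * j / 2 = j := by omega
  have e2 : (2 * j + 1) / 2 = j := by omega
  have e3 : 2 * j % 2 = 0 := by omega
  have e4 : (2 * j + 1) % 2 = 1 := by omega
  simp only [blockFactor, midPattern, pattern, e1, e2, e3, e4, if_true, one_ne_zero, if_false,
    columnFactor, mul_inv]
  split_ifs <;> first | omega | ring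

/-- The pattern after two renewal steps, up to a factor for every column of blocks. -/
noncomputable def innerPattern (a b c d : ℕ → ℝ) : ℕ → ℕ → ℝ :=
  pattern (fun j => (b j)⁻¹) (fun j => (a (j + 2))⁻¹) (fun j => (d j)⁻¹) (fun j => (c (j + 2))⁻¹)

lemma renewal_pattern (ha : ∀ i, 0 < a i) (hb : ∀ i, 0 < b i) (hc : ∀ i, 0 < c i)
    (hd : ∀ i, 0 < d i) (r s : ℕ) :
    renewal (pattern a b c d) (r + 1) (s + 1) = midPattern a b c d r s * 2⁻¹ := by
  have ha' := fun i => (ha i).ne'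
  have hb' := fun i => (hb i).ne'
  have hc' := fun i => (hc i).ne'
  have hd' := fun i => (hd i).ne'
  rw [renewal, blockFactor_pattern]
  obtain ⟨m, rfl | rfl⟩ := Nat.even_or_odd' s
  · have e1 : (2 * m + 1) / 2 = m := by omega
    have e2 : 2 * m + 1 - (2 * m + 1) % 2 = 2 * m := by omega
    have e3 : 2 * m % 2 = 0 := by omega
    have e4 : 2 * m / 2 = m := by omega
    simp only [midPattern, pattern, e1, e2, e3, e4, if_true]
    split_ifs <;> first | omega | (field_simp [ha', hb', hc', hd'])
  · have e1 : (2 * m + 1 + 1) / 2 = m + 1 := by omega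
    have e2 : 2 * (m + 1) + 1 - (2 * m + 1 + 1) % 2 = 2 * m + 3 := by omega
    have e3 : (2 * m + 3) % 2 = 1 := by omega
    have e4 : (2 * m + 3) / 2 = m + 1 := by omega
    have e5 : (2 * m + 1) % 2 = 1 := by omega
    have e6 : (2 * m + 1) / 2 = m := by omega
    simp only [midPattern, pattern, e1, e2, e3, e4, e5, e6, one_ne_zero, if_false]
    split_ifs <;> first | omega | (field_simp [ha', hb', hc', hd'])

lemma renewal_midPattern (r s : ℕ) :
    renewal (midPattern a b c d) (r + 1) (s + 1) =
      innerPattern a b c d r s * (columnFactor a b c d ((s + 1) / 2))⁻¹ := by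
  rw [renewal, blockFactor_midPattern, div_eq_mul_inv]
  congr 1
  obtain ⟨m, rfl | rfl⟩ := Nat.even_or_odd' s
  · have e1 : (2 * m + 1) / 2 = m := by omega
    have e2 : 2 * m + 1 - (2 * m + 1) % 2 = 2 * m := by omega
    have e3 : 2 * m % 2 = 0 := by omega
    have e4 : 2 * m / 2 = m := by omega
    simp only [midPattern, innerPattern, pattern, e1, e2, e3, e4, if_true]
    exact if_congr (by omega) rfl rfl
  · have e1 : (2 * m + 1 + 1) / 2 = m + 1 := by omega
    have e2 : 2 * (m + 1) + 1 - (2 * m + 1 + 1) % 2 = 2 * m + 3 := by omega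
    have e3 : (2 * m + 3) % 2 = 1 := by omega
    have e4 : (2 * m + 3) / 2 = m + 1 := by omega
    have e5 : (2 * m + 1) % 2 = 1 := by omega
    have e6 : (2 * m + 1) / 2 = m := by omega
    simp only [midPattern, innerPattern, pattern, e1, e2, e3, e4, e5, e6, one_ne_zero, if_false]
    exact if_congr (by omega) rfl rfl

lemma prod_range_alternate (x y : ℝ) (N : ℕ) :
    ∏ i ∈ range N, (if i % 2 = 0 then x else y) = x ^ ((N + 1) / 2) * y ^ (N / 2) := by
  induction N with
  | zero => simp
  | succ N ih =>
    rw [prod_range_succ, ih]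
    obtain ⟨m, rfl | rfl⟩ := Nat.even_or_odd' N
    · have e1 : (2 * m + 1) / 2 = m := by omega
      have e2 : 2 * m / 2 = m := by omega
      have e3 : (2 * m + 1 + 1) / 2 = m + 1 := by omega
      have e4 : 2 * m % 2 = 0 := by omega
      simp only [e1, e2, e3, e4, if_true]
      ring
    · have e1 : (2 * m + 1) / 2 = m := by omega
      have e2 : (2 * m + 1 + 1 + 1) / 2 = m + 1 := by omega
      have e3 : (2 * m + 1 + 1) / 2 = m + 1 := by omega
      have e4 : (2 * m + 1) % 2 = 1 := by omega
      simp only [e1, e2, e3, e4, one_ne_zero, if_false]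
      ring

/-- The first renewal contributes `2ab` from the even block rows and `2cd` from the odd ones, the
second the column factors to the power `n + 1`. Rescaling the columns cancels all but `2 ^ (n + 2)`
and one copy of each column factor. -/
lemma gf_pattern_add_two (ha : ∀ i, 0 < a i) (hb : ∀ i, 0 < b i) (hc : ∀ i, 0 < c i)
    (hd : ∀ i, 0 < d i) (n : ℕ) :
    gf (n + 2) (pattern a b c d) = 2 ^ (n + 2) *
      ((∏ j ∈ range (n + 2), a (j + 1)) * ∏ j ∈ range (n + 2), b (j + 1)) ^ ((n + 1) / 2 + 1) *
      ((∏ j ∈ range (n + 2), c (j + 1)) * ∏ j ∈ range (n + 2), d (j + 1)) ^ (n / 2 + 1) *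
      (∏ j ∈ range (n + 1), columnFactor a b c d j) * gf n (innerPattern a b c d) := by
  have hcol (j : ℕ) : columnFactor a b c d j ≠ 0 := by
    have := ha (j + 2); have := hb (j + 1); have := hc (j + 2); have := hd (j + 1)
    unfold columnFactor
    positivity
  have hprod : ∏ j ∈ range (n + 1), columnFactor a b c d j ≠ 0 :=
    prod_ne_zero_iff.2 fun j _ => hcol j
  rw [gf_succ (n := n + 1)]
  · simp only [renewal_pattern ha hb hc hd]
    rw [gf_mul_column (n := n + 1) (midPattern a b c d) (fun _ => 2⁻¹), gf_succ]
    · simp only [renewal_midPattern, blockFactor_midPattern, blockFactor_pattern]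
      rw [gf_mul_column (n := n) (innerPattern a b c d) (fun j => (columnFactor a b c d j)⁻¹),
        prod_comm, prod_congr rfl fun j _ => prod_range_alternate _ _ (n + 1 + 1)]
      have e1 : (n + 1 + 1 + 1) / 2 = (n + 1) / 2 + 1 := by omega
      have e2 : (n + 1 + 1) / 2 = n / 2 + 1 := by omega
      have e3 : n + 1 + 1 = (n + 1) / 2 + 1 + (n / 2 + 1) := by omega
      simp only [e1, e2, prod_mul_distrib, prod_pow, prod_const, card_range, prod_inv_distrib,
        mul_pow, pow_succ (∏ j ∈ range (n + 1), columnFactor a b c d j) n]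
      have e4 : ((2 : ℝ)⁻¹ ^ (n + 1 + 1)) ^ (n + 1) *
          (((2 : ℝ) ^ (n + 1 + 1)) ^ ((n + 1) / 2 + 1) * (2 ^ (n + 1 + 1)) ^ (n / 2 + 1)) =
          2 ^ (n + 1 + 1) := by
        rw [← pow_add, ← e3]
        have h2 : (2 : ℝ) ^ (n + 1 + 1) ≠ 0 := by positivity
        rw [inv_pow, inv_pow, pow_succ (2 ^ (n + 1 + 1) : ℝ) (n + 1), inv_mul_cancel_left₀ (pow_ne_zero _ h2)]
      have e5 : (∏ j ∈ range (n + 1), columnFactor a b c d j) ^ n *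
          (∏ j ∈ range (n + 1), columnFactor a b c d j)⁻¹ ^ n = 1 := by
        rw [← mul_pow, mul_inv_cancel₀ hprod, one_pow]
      generalize (2 : ℝ)⁻¹ ^ (n + 1 + 1) = x, (2 : ℝ) ^ (n + 1 + 1) = w at e4 ⊢
      generalize ∏ j ∈ range (n + 1), columnFactor a b c d j = F at e5 ⊢
      generalize ∏ j ∈ range (n + 1 + 1), a (j + 1) = A, ∏ j ∈ range (n + 1 + 1), b (j + 1) = B,
        ∏ j ∈ range (n + 1 + 1), c (j + 1) = C, ∏ j ∈ range (n + 1 + 1), d (j + 1) = D,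
        gf n (innerPattern a b c d) = G
      linear_combination (A * B) ^ ((n + 1) / 2 + 1) * (C * D) ^ (n / 2 + 1) * F * G *
        (F ^ n * F⁻¹ ^ n * e4 + w * e5)
    · intro i _ j _
      rw [blockFactor_midPattern]
      exact hcol j
  · intro i _ j _
    rw [blockFactor_pattern]
    have := ha (j + 1); have := hb (j + 1); have := hc (j + 1); have := hd (j + 1)
    split_ifs <;> positivity

end AztecSquares

/-! ### The product formula satisfies the same recursion -/

namespace AztecSquares

open Finset

lemma prod_range_sub (f : ℕ → ℝ) {j N : ℕ} (hj : j ≤ N) :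
    ∏ i ∈ range j, f (N - i) = ∏ i ∈ Ico (N - j) N, f (i + 1) := by
  refine prod_nbij' (fun i => N - 1 - i) (fun i => N - 1 - i) ?_ ?_ ?_ ?_ ?_ <;>
    simp only [mem_range, mem_Ico] <;> intro i hi
  · omega
  · omega
  · omega
  · omega
  · congr 1
    omega

/-- The three index ranges `[1, j + 1]`, `[N - j + 1, N]` and `[j + 2, N - j]` partition `[1, N]`.
-/
lemma prod_layer (f : ℕ → ℝ) {j N : ℕ} (hj : 2 * j + 1 ≤ N) :
    (∏ i ∈ range (j + 1), f (i + 1)) * (∏ i ∈ range j, f (N - i)) *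
      ∏ i ∈ Ico (j + 1) (N - j), f (i + 1) = ∏ i ∈ range N, f (i + 1) := by
  rw [prod_range_sub f (by omega), mul_right_comm, prod_range_mul_prod_Ico _ (by omega),
    prod_range_mul_prod_Ico _ (by omega)]

lemma prod_layer_reflect (f : ℕ → ℝ) {j N : ℕ} (hj : 2 * j + 1 ≤ N) :
    (∏ i ∈ range (j + 1), f (N - i)) * (∏ i ∈ range j, f (i + 1)) *
      ∏ i ∈ Ico (j + 1) (N - j), f i = ∏ i ∈ range N, f (i + 1) := by
  have h : ∏ i ∈ Ico (j + 1) (N - j), f i = ∏ i ∈ Ico j (N - (j + 1)), f (i + 1) := by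
    rw [show N - j = N - (j + 1) + 1 by omega, ← prod_Ico_add' f j (N - (j + 1)) 1]
  rw [prod_range_sub f (by omega), h, mul_assoc, prod_range_mul_prod_Ico _ (by omega), mul_comm,
    prod_range_mul_prod_Ico _ (by omega)]

lemma prod_range_prod_range_zero (g : ℕ → ℕ → ℝ) (r : ℕ) :
    ∏ j ∈ range (r + 1), ∏ i ∈ range j, g j i = ∏ j ∈ range r, ∏ i ∈ range (j + 1), g (j + 1) i := by
  rw [prod_range_succ']
  simp

lemma prod_layers (f : ℕ → ℝ) {r N : ℕ} (hr : 2 * r + 1 ≤ N) :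
    (∏ j ∈ range (r + 1), ∏ i ∈ range (j + 1), f (i + 1)) *
      (∏ j ∈ range r, ∏ i ∈ range (j + 1), f (N - i)) *
      ∏ j ∈ range (r + 1), ∏ i ∈ Ico (j + 1) (N - j), f (i + 1) =
    (∏ i ∈ range N, f (i + 1)) ^ (r + 1) := by
  rw [← prod_range_prod_range_zero (fun _ i => f (N - i)), ← prod_mul_distrib, ← prod_mul_distrib,
    prod_congr rfl fun j hj => prod_layer f (by rw [mem_range] at hj; omega), prod_const,
    card_range]

lemma prod_layers_reflect (f : ℕ → ℝ) {r N : ℕ} (hr : 2 * r + 1 ≤ N) :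
    (∏ j ∈ range (r + 1), ∏ i ∈ range (j + 1), f (N - i)) *
      (∏ j ∈ range r, ∏ i ∈ range (j + 1), f (i + 1)) *
      ∏ j ∈ range (r + 1), ∏ i ∈ Ico (j + 1) (N - j), f i =
    (∏ i ∈ range N, f (i + 1)) ^ (r + 1) := by
  rw [← prod_range_prod_range_zero (fun _ i => f (i + 1)), ← prod_mul_distrib, ← prod_mul_distrib,
    prod_congr rfl fun j hj => prod_layer_reflect f (by rw [mem_range] at hj; omega), prod_const,
    card_range]

/-- `∏ j ∈ [0, r), ∏ i ∈ [0, j], f i`, which is the product of the `f i ^ (r - i)`. -/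
def staircase (f : ℕ → ℝ) (r : ℕ) : ℝ := ∏ j ∈ range r, ∏ i ∈ range (j + 1), f i

lemma staircase_eq_prod_pow (f : ℕ → ℝ) (r : ℕ) :
    staircase f r = ∏ i ∈ range r, f i ^ (r - i) := by
  unfold staircase
  induction r with
  | zero => simp
  | succ r ih =>
    rw [prod_range_succ, ih, prod_range_succ, prod_range_succ, ← mul_assoc, ← prod_mul_distrib]
    congr 1
    · refine prod_congr rfl fun i hi => ?_
      rw [mem_range] at hi
      rw [← pow_succ]
      congr 1
      omega
    · simp

/-- `∏ j ∈ [1, q], ∏ i ∈ [j, n - j], f i`, with `j` counted from `0`. -/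
def triangle (n q : ℕ) (f : ℕ → ℝ) : ℝ := ∏ j ∈ range q, ∏ i ∈ Ico (j + 1) (n - j), f i

lemma triangle_mul (n q : ℕ) (f g : ℕ → ℝ) :
    triangle n q (fun i => f i * g i) = triangle n q f * triangle n q g := by
  simp only [triangle, prod_mul_distrib]

lemma triangle_inv (n q : ℕ) (f : ℕ → ℝ) :
    triangle n q (fun i => (f i)⁻¹) = (triangle n q f)⁻¹ := by
  simp only [triangle, prod_inv_distrib]

lemma triangle_succ (n q : ℕ) (f : ℕ → ℝ) :
    triangle (n + 2) (q + 1) f =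
      (∏ j ∈ range (n + 1), f (j + 1)) * triangle n q (fun i => f (i + 1)) := by
  unfold triangle
  rw [prod_range_succ', mul_comm]
  congr 1
  · rw [range_eq_Ico, prod_Ico_add' f 0 (n + 1) 1]
    rfl
  · refine prod_congr rfl fun j _ => ?_
    rw [prod_Ico_add' f (j + 1) (n - j) 1]
    by_cases h : j ≤ n
    · congr 2
      omega
    · rw [Ico_eq_empty (by omega), Ico_eq_empty (by omega)]

lemma staircase_inv (f : ℕ → ℝ) (r : ℕ) : staircase (fun i => (f i)⁻¹) r = (staircase f r)⁻¹ := by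
  simp only [staircase, prod_inv_distrib]

/-- The product formula for the matching generating function of the pattern. -/
def closedForm (n : ℕ) (a b c d : ℕ → ℝ) : ℝ :=
  2 ^ ((n + 1) / 2 * (n / 2 + 1)) *
    (staircase (fun i => a (i + 1)) ((n + 1) / 2) * staircase (fun i => b (n - i)) ((n + 1) / 2)) *
    (staircase (fun i => c (i + 1)) (n / 2) * staircase (fun i => d (n - i)) (n / 2)) *
    triangle n (n / 2) (fun i => d i * a (i + 1) + b i * c (i + 1))

lemma triangle_ne_zero {n q : ℕ} {f : ℕ → ℝ} (hf : ∀ i, f i ≠ 0) : triangle n q f ≠ 0 :=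
  prod_ne_zero_iff.2 fun _ _ => prod_ne_zero_iff.2 fun _ _ => hf _

lemma staircase_ne_zero {r : ℕ} {f : ℕ → ℝ} (hf : ∀ i, f i ≠ 0) : staircase f r ≠ 0 :=
  prod_ne_zero_iff.2 fun _ _ => prod_ne_zero_iff.2 fun _ _ => hf _

/-- For odd `n` the additional row of the triangle is empty. -/
lemma triangle_half (n : ℕ) (f : ℕ → ℝ) :
    triangle (n + 2) ((n + 1) / 2 + 1) f = triangle (n + 2) (n / 2 + 1) f := by
  rcases Nat.even_or_odd' n with ⟨m, rfl | rfl⟩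
  · rw [show (2 * m + 1) / 2 = 2 * m / 2 by omega]
  · rw [show (2 * m + 1 + 1) / 2 = m + 1 by omega, show (2 * m + 1) / 2 = m by omega]
    unfold triangle
    rw [prod_range_succ, Ico_eq_empty (a := m + 1 + 1) (by omega), prod_empty, mul_one]

/-- The numerators of the column factors form the first row of the new triangle, and the old
triangle supplies the rest. The denominators form triangles in `a`, `b`, `c`, `d` separately; with
the old and new staircases they fill whole rows `[1, n + 2]`, which gives the powers of full
products. -/
lemma closedForm_add_two {a b c d : ℕ → ℝ} (ha : ∀ i, 0 < a i) (hb : ∀ i, 0 < b i)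
    (hc : ∀ i, 0 < c i) (hd : ∀ i, 0 < d i) (n : ℕ) :
    closedForm (n + 2) a b c d = 2 ^ (n + 2) *
      ((∏ j ∈ range (n + 2), a (j + 1)) * ∏ j ∈ range (n + 2), b (j + 1)) ^ ((n + 1) / 2 + 1) *
      ((∏ j ∈ range (n + 2), c (j + 1)) * ∏ j ∈ range (n + 2), d (j + 1)) ^ (n / 2 + 1) *
      (∏ j ∈ range (n + 1), columnFactor a b c d j) *
      closedForm n (fun j => (b j)⁻¹) (fun j => (a (j + 2))⁻¹) (fun j => (d j)⁻¹)
        (fun j => (c (j + 2))⁻¹) := by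
  have ha' := fun i => (ha i).ne'
  have hb' := fun i => (hb i).ne'
  have hc' := fun i => (hc i).ne'
  have hd' := fun i => (hd i).ne'
  have hA := prod_layers a (r := (n + 1) / 2) (N := n + 2) (by omega)
  have hB := prod_layers_reflect b (r := (n + 1) / 2) (N := n + 2) (by omega)
  have hC := prod_layers c (r := n / 2) (N := n + 2) (by omega)
  have hD := prod_layers_reflect d (r := n / 2) (N := n + 2) (by omega)
  have hrefl (f : ℕ → ℝ) (r : ℕ) (hr : r ≤ n + 1) :
      staircase (fun i => (f (n - i + 2))⁻¹) r =
        (staircase (fun i => f (n + 2 - i)) r)⁻¹ := by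
    rw [staircase_inv]
    refine congrArg _ (prod_congr rfl fun j hj => prod_congr rfl fun i hi => ?_)
    rw [mem_range] at hi hj
    beta_reduce
    rw [show n - i + 2 = n + 2 - i by omega]
  set E : ℕ → ℝ := fun i => d i * a (i + 1) + b i * c (i + 1) with hE
  have hcolumn (j : ℕ) : columnFactor a b c d j =
      E (j + 1) * ((a (j + 1 + 1) * b (j + 1)) * (c (j + 1 + 1) * d (j + 1)))⁻¹ := by
    simp only [columnFactor, hE]
    field_simp [ha', hb', hc', hd']
  have htri : triangle n (n / 2) (fun i => (c (i + 2))⁻¹ * (b (i + 1))⁻¹ +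
      (a (i + 2))⁻¹ * (d (i + 1))⁻¹) = triangle n (n / 2) (fun j =>
        E (j + 1) * ((a (j + 1 + 1) * b (j + 1)) * (c (j + 1 + 1) * d (j + 1)))⁻¹) := by
    congr 1
    funext j
    rw [← hcolumn, columnFactor]
    simp only [mul_inv]
    ring
  unfold closedForm
  rw [prod_congr rfl fun j _ => hcolumn j, htri, hrefl a _ (by omega), hrefl c _ (by omega),
    staircase_inv, staircase_inv]
  have hsucc := triangle_succ n (n / 2)
    (fun j => E j * ((a (j + 1) * b j) * (c (j + 1) * d j))⁻¹)
  rw [triangle_mul _ _ E, triangle_inv, triangle_mul, triangle_mul, triangle_mul] at hsucc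
  have ha1 := triangle_ne_zero (n := n + 2) (q := n / 2 + 1) fun i => ha' (i + 1)
  have hb1 := triangle_ne_zero (n := n + 2) (q := n / 2 + 1) hb'
  have hc1 := triangle_ne_zero (n := n + 2) (q := n / 2 + 1) fun i => hc' (i + 1)
  have hd1 := triangle_ne_zero (n := n + 2) (q := n / 2 + 1) hd'
  have ha2 := staircase_ne_zero (r := (n + 1) / 2) fun i => ha' (n + 2 - i)
  have hb2 := staircase_ne_zero (r := (n + 1) / 2) fun i => hb' (i + 1)
  have hc2 := staircase_ne_zero (r := n / 2) fun i => hc' (n + 2 - i)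
  have hd2 := staircase_ne_zero (r := n / 2) fun i => hd' (i + 1)
  change staircase _ _ * staircase _ _ * triangle _ _ _ = _ at hA hB hC hD
  rw [triangle_half] at hA hB
  rw [mul_pow, mul_pow, ← hA, ← hB, ← hC, ← hD]
  have e1 : (n + 2 + 1) / 2 = (n + 1) / 2 + 1 := by omega
  have e2 : (n + 2) / 2 = n / 2 + 1 := by omega
  have e3 : ((n + 1) / 2 + 1) * (n / 2 + 1 + 1) = n + 2 + (n + 1) / 2 * (n / 2 + 1) := by
    have : n = (n + 1) / 2 + n / 2 := by omega
    generalize (n + 1) / 2 = p, n / 2 = q at this ⊢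
    subst this
    ring
  rw [e1, e2, e3, pow_add]
  change _ * triangle _ _ E = _
  generalize (∏ j ∈ range (n + 1), E (j + 1) *
    (a (j + 1 + 1) * b (j + 1) * (c (j + 1 + 1) * d (j + 1)))⁻¹) = K at hsucc ⊢
  generalize (triangle n (n / 2) fun j => E (j + 1) *
    (a (j + 1 + 1) * b (j + 1) * (c (j + 1 + 1) * d (j + 1)))⁻¹) = L at hsucc ⊢
  rw [mul_assoc _ K, mul_left_comm K, ← hsucc]
  field_simp

lemma closedForm_zero (a b c d : ℕ → ℝ) : closedForm 0 a b c d = 1 := by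
  simp [closedForm, staircase, triangle]

lemma closedForm_one (a b c d : ℕ → ℝ) : closedForm 1 a b c d = 2 * (a 1 * b 1) := by
  simp [closedForm, staircase, triangle]

theorem gf_pattern (n : ℕ) : ∀ {a b c d : ℕ → ℝ}, (∀ i, 0 < a i) → (∀ i, 0 < b i) →
    (∀ i, 0 < c i) → (∀ i, 0 < d i) → gf n (pattern a b c d) = closedForm n a b c d := by
  induction n using Nat.twoStepInduction with
  | zero =>
    intros
    rw [gf_zero, closedForm_zero]
  | one =>
    intro a b c d ha hb _ _
    rw [gf_succ (n := 0), gf_zero, closedForm_one]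
    · simp [blockFactor_pattern]
    · intro i hi j hj
      obtain rfl : i = 0 := by omega
      rw [blockFactor_pattern, if_pos rfl]
      exact (mul_pos two_pos (mul_pos (ha _) (hb _))).ne'
  | more n ih _ =>
    intro a b c d ha hb hc hd
    rw [gf_pattern_add_two ha hb hc hd, closedForm_add_two ha hb hc hd, innerPattern, ih]
    exacts [fun i => inv_pos.2 (hb i), fun i => inv_pos.2 (ha _), fun i => inv_pos.2 (hd i),
      fun i => inv_pos.2 (hc _)]

/-! ### Passage to the stated products and hypotheses -/

lemma prod_Icc_one (f : ℕ → ℝ) (r : ℕ) : ∏ i ∈ Icc 1 r, f i = ∏ i ∈ range r, f (i + 1) := by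
  rw [range_eq_Ico, prod_Ico_add' f 0 r 1]
  rfl

lemma staircase_mul_staircase (f g : ℕ → ℝ) (n r : ℕ) :
    staircase (fun i => f (i + 1)) r * staircase (fun i => g (n - i)) r =
      ∏ i ∈ Icc 1 r, (f i * g (n + 1 - i)) ^ (r + 1 - i) := by
  rw [staircase_eq_prod_pow, staircase_eq_prod_pow, prod_Icc_one, ← prod_mul_distrib]
  refine prod_congr rfl fun i _ => ?_
  rw [← mul_pow, Nat.add_sub_add_right, Nat.add_sub_add_right]

lemma triangle_eq_prod_Icc (n q : ℕ) (hq : q ≤ n) (f : ℕ → ℝ) :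
    triangle n q f = ∏ j ∈ Icc 1 q, ∏ i ∈ Icc j (n - j), f i := by
  rw [prod_Icc_one]
  refine prod_congr rfl fun j hj => ?_
  rw [mem_range] at hj
  congr 1
  ext i
  simp only [mem_Ico, mem_Icc]
  omega

/-- The product formula depends only on the entries of the pattern. -/
lemma closedForm_congr {n : ℕ} {a b c d a' b' c' d' : ℕ → ℝ} (ha : ∀ i ∈ Icc 1 n, a i = a' i)
    (hb : ∀ i ∈ Icc 1 n, b i = b' i) (hc : ∀ i ∈ Icc 1 n, c i = c' i)
    (hd : ∀ i ∈ Icc 1 n, d i = d' i) : closedForm n a b c d = closedForm n a' b' c' d' := by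
  have hs {f g : ℕ → ℝ} {r : ℕ} (h : ∀ i < r, f i = g i) : staircase f r = staircase g r := by
    refine prod_congr rfl fun j hj => prod_congr rfl fun i hi => h i ?_
    rw [mem_range] at hi hj
    omega
  unfold closedForm
  congr 1
  · congr 1
    · congr 2
      · exact hs fun i hi => ha _ (mem_Icc.2 (by omega))
      · exact hs fun i hi => hb _ (mem_Icc.2 (by omega))
    · congr 1
      · exact hs fun i hi => hc _ (mem_Icc.2 (by omega))
      · exact hs fun i hi => hd _ (mem_Icc.2 (by omega))
  · refine prod_congr rfl fun j hj => prod_congr rfl fun i hi => ?_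
    rw [mem_range] at hj
    rw [mem_Ico] at hi
    beta_reduce
    rw [ha (i + 1), hb i, hc (i + 1), hd i] <;> exact mem_Icc.2 (by omega)

/-- Extension of a sequence given on `[1, n]` by ones. -/
def extendOne (n : ℕ) (f : ℕ → ℝ) (i : ℕ) : ℝ := if i ∈ Icc 1 n then f i else 1

lemma extendOne_pos {n : ℕ} {f : ℕ → ℝ} (hf : ∀ i ∈ Icc 1 n, 0 < f i) (i : ℕ) :
    0 < extendOne n f i := by
  unfold extendOne
  split_ifs with h
  exacts [hf i h, one_pos]

lemma extendOne_of_mem {n : ℕ} {f : ℕ → ℝ} {i : ℕ} (h : i ∈ Icc 1 n) : extendOne n f i = f i :=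
  if_pos h

theorem aztecGF_fourRowPattern (n : ℕ) [NeZero n] {a b c d : ℕ → ℝ}
    (ha : ∀ i ∈ Icc 1 n, 0 < a i) (hb : ∀ i ∈ Icc 1 n, 0 < b i)
    (hc : ∀ i ∈ Icc 1 n, 0 < c i) (hd : ∀ i ∈ Icc 1 n, 0 < d i) :
    aztecGF n (fourRowPattern n a b c d) = closedForm n a b c d := by
  -- The recursion needs positivity at every index, while it is given only on `[1, n]`; neither side
  -- sees the entries outside.
  have h : closedForm n a b c d =
      closedForm n (extendOne n a) (extendOne n b) (extendOne n c) (extendOne n d) :=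
    closedForm_congr (fun i hi => (extendOne_of_mem hi).symm)
      (fun i hi => (extendOne_of_mem hi).symm) (fun i hi => (extendOne_of_mem hi).symm)
      (fun i hi => (extendOne_of_mem hi).symm)
  rw [h, ← gf_pattern n (extendOne_pos ha) (extendOne_pos hb) (extendOne_pos hc)
    (extendOne_pos hd)]
  refine gf_congr fun r _ s hs => ?_
  have hm : s / 2 + 1 ∈ Icc 1 n := mem_Icc.2 (by omega)
  simp only [periodicArray, fourRowPattern, pattern, Matrix.of_apply, Fin.val_ofNat,
    Nat.mod_eq_of_lt hs, extendOne_of_mem hm]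

end AztecSquares

theorem theorem3p3 (n : ℕ) [NeZero n] (a b c d : ℕ → ℝ)
    (ha : ∀ i ∈ Finset.Icc 1 n, 0 < a i) (hb : ∀ i ∈ Finset.Icc 1 n, 0 < b i)
    (hc : ∀ i ∈ Finset.Icc 1 n, 0 < c i) (hd : ∀ i ∈ Finset.Icc 1 n, 0 < d i) :
    (∀ k : ℕ, n = 2 * k →
      aztecGF n (fourRowPattern n a b c d) =
        2 ^ (k * (k + 1)) *
          (∏ i ∈ Finset.Icc 1 k,
            (a i * b (n + 1 - i) * c i * d (n + 1 - i)) ^ (k + 1 - i)) *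
          ∏ j ∈ Finset.Icc 1 k, ∏ i ∈ Finset.Icc j (n - j),
            (d i * a (i + 1) + b i * c (i + 1))) ∧
    (∀ k : ℕ, n = 2 * k + 1 →
      aztecGF n (fourRowPattern n a b c d) =
        2 ^ ((k + 1) ^ 2) *
          (∏ i ∈ Finset.Icc 1 (k + 1),
            (a i * b (n + 1 - i)) ^ (k + 2 - i) * (c i * d (n + 1 - i)) ^ (k + 1 - i)) *
          ∏ j ∈ Finset.Icc 1 k, ∏ i ∈ Finset.Icc j (n - j),
            (d i * a (i + 1) + b i * c (i + 1))) := by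
  rw [AztecSquares.aztecGF_fourRowPattern n ha hb hc hd, AztecSquares.closedForm,
    AztecSquares.staircase_mul_staircase, AztecSquares.staircase_mul_staircase,
    AztecSquares.triangle_eq_prod_Icc n _ (by omega)]
  constructor
  · intro k hk
    have e1 : (n + 1) / 2 = k := by omega
    have e2 : n / 2 = k := by omega
    rw [e1, e2, mul_assoc (2 ^ _), ← Finset.prod_mul_distrib]
    congr 2
    refine Finset.prod_congr rfl fun i _ => ?_
    rw [← mul_pow, ← mul_assoc]
  · intro k hk
    have e1 : (n + 1) / 2 = k + 1 := by omega
    have e2 : n / 2 = k := by omega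
    rw [e1, e2, mul_assoc (2 ^ _), sq, Finset.prod_mul_distrib]
    congr 3
    -- The `c, d` factor at `i = k + 1` has exponent zero, so its product may stop at `k`.
    rw [Finset.prod_Icc_succ_top (by omega), Nat.sub_self, pow_zero, mul_one]
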